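/- Let $N\ge 1$ be an integer, let $\{k_1,\dots,k_M\}$ ($M\ge 0$) be a set of $M$ distinct integers with $0<k_j<N$, and put $\Lambda=\{0,\dots,N\}\setminus\{k_1,\dots,k_M\}$. Let $\mathcal P(\Lambda)$ be the complex vector space of polynomials $\sum_{k\in\Lambda}c_kz^k$, $c_k\in\mathbb C$, normed by $$\|p\|_1=\frac1{2\pi}\int_{\mathbb T}|p(\zeta)|\,|d\zeta|,\qquad \mathbb T=\{\zeta\in\mathbb C:|\zeta|=1\},$$ and let $\mathrm{ball}(\mathcal P(\Lambda))=\{q\in\mathcal P(\Lambda):\|q\|_1\le 1\}$. For $p(z)=\sum_{k=0}^Nc_kz^k\in\mathcal P(\Lambda)$ with $\|p\|_1=1$, let $p^*(z)=\sum_{k=0}^N\overline{c_k}\,z^{N-k}$, let $a_1,\dots,a_n$ be the distinct common zeros of $p$ and $p^*$ in the open unit disk $\mathbb D=\{z\in\mathbb C:|z|<1\}$, and put $$m=\sum_{j=1}^n\min\{\mathrm{mult}(a_j,p),\,\mathrm{mult}(a_j,p^*)\},$$ where $\mathrm{mult}(a,q)$ is the multiplicity of $a$ as a zero of $q$. If $M<m$,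 then $p$ is not an extreme point of $\mathrm{ball}(\mathcal P(\Lambda))$. -/

import Mathlib

namespace Fewnomial

open Polynomial

/-- The set `Λ = {0, …, N} \ K` of admissible frequencies, `K` being the finite set of
forbidden ones. -/
def freqSet (N : ℕ) (K : Finset ℕ) : Finset ℕ :=
  Finset.range (N + 1) \ K

/-- The complex vector space `𝒫(Λ)` of the polynomials `∑_{k ∈ Λ} c_k z^k`. -/
def polySpace (L : Finset ℕ) : Submodule ℂ ℂ[X] where
  carrier := {p | ∀ k, k ∉ L → p.coeff k = 0}
  zero_mem' := by
    intro k _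
    simp
  add_mem' := by
    intro p q hp hq k hk
    simp [hp k hk, hq k hk]
  smul_mem' := by
    intro c p hp k hk
    simp [hp k hk]

/-- The norm `‖p‖₁ = (1 / 2π) ∫ |p(ζ)| |dζ|` over the unit circle. -/
noncomputable def l1Norm (p : ℂ[X]) : ℝ :=
  (2 * Real.pi)⁻¹ * ∫ t in (0 : ℝ)..(2 * Real.pi), ‖p.eval (Complex.exp (t * Complex.I))‖

/-- The closed unit ball of `(𝒫(Λ), ‖·‖₁)`. -/
def unitBall (L : Finset ℕ) : Set (polySpace L) :=
  {p | l1Norm (p : ℂ[X]) ≤ 1}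

/-- For `p = ∑_{k ≤ N} c_k z^k`, the polynomial `p* = ∑_{k ≤ N} conj(c_k) z^(N-k)`. -/
noncomputable def starPoly (N : ℕ) (p : ℂ[X]) : ℂ[X] :=
  ∑ k ∈ Finset.range (N + 1), C (starRingEnd ℂ (p.coeff k)) * X ^ (N - k)

open Classical in
/-- The distinct common zeros of `p` and `q` in the open unit disk (for `p, q ≠ 0`). -/
noncomputable def commonZeros (p q : ℂ[X]) : Finset ℂ :=
  (p.roots.toFinset ∩ q.roots.toFinset).filter (fun a => ‖a‖ < 1)

/-- The number `m = ∑_j min {mult(a_j, p), mult(a_j, p*)}`, where the `a_j` are the distinct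
common zeros of `p` and `p*` in the open unit disk. -/
noncomputable def commonMult (N : ℕ) (p : ℂ[X]) : ℕ :=
  ∑ a ∈ commonZeros p (starPoly N p),
    min (p.rootMultiplicity a) ((starPoly N p).rootMultiplicity a)

end Fewnomial

namespace Fewnomial

open Polynomial

/-! Collecting the common zeros in the disk gives `p = G G* r` with `deg G = m` and `deg r ≤ N -
2m`. On the circle `G G* = z^m |G|^2`, and `|G|^2 > 0` there. Replace `|G|^2` by `|G|^2 + sT`, with
`T` a real trigonometric polynomial of degree at most `m`. For small real `s` this factor stays
nonnegative, so the norm is affine in `s` with slope proportional to `∫ |r| T`. Killing the slope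
and the `M` forbidden coefficients of `z^m T r` costs `2M + 1` real equations, while `T` has `2m +
1` real parameters. If `M < m`, some `T ≠ 0` survives, and `p` is the midpoint of two distinct
points `p ± ε z^m T r` of norm 1. -/

theorem starPoly_eq_reflect {N : ℕ} {p : ℂ[X]} (hp : p.natDegree ≤ N) :
    starPoly N p = reflect N (p.map (starRingEnd ℂ)) := by
  have h : p.map (starRingEnd ℂ) =
      ∑ k ∈ Finset.range (N + 1), C (starRingEnd ℂ (p.coeff k)) * X ^ k := by
    rw [as_sum_range_C_mul_X_pow' (p := p.map (starRingEnd ℂ)) (n := N + 1)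
      (by rw [natDegree_map]; omega)]
    simp
  ext i
  rw [h, coeff_reflect, starPoly, finsetSum_coeff, finsetSum_coeff]
  refine Finset.sum_congr rfl fun k hk => ?_
  have hk' : k ≤ N := by simpa [Nat.lt_succ_iff] using hk
  rw [coeff_C_mul_X_pow, coeff_C_mul_X_pow]
  congr 1
  rw [← revAt_le hk', eq_iff_iff]
  constructor
  · rintro rfl; simp
  · intro h; rw [← h]; simp

theorem natDegree_starPoly_le (N : ℕ) (p : ℂ[X]) : (starPoly N p).natDegree ≤ N := by
  refine natDegree_sum_le_of_forall_le _ _ fun k _ => ?_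
  exact (natDegree_C_mul_X_pow_le _ _).trans (Nat.sub_le _ _)

theorem starPoly_starPoly {N : ℕ} {p : ℂ[X]} (hp : p.natDegree ≤ N) :
    starPoly N (starPoly N p) = p := by
  rw [starPoly_eq_reflect (natDegree_starPoly_le N p), starPoly_eq_reflect hp, reflect_map,
    reflect_reflect, Polynomial.map_map]
  ext i
  simp

theorem starPoly_mul {m n : ℕ} {f g : ℂ[X]} (hf : f.natDegree ≤ m) (hg : g.natDegree ≤ n) :
    starPoly (m + n) (f * g) = starPoly m f * starPoly n g := by
  rw [starPoly_eq_reflect hf, starPoly_eq_reflect hg,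
    starPoly_eq_reflect (natDegree_mul_le.trans (add_le_add hf hg)), Polynomial.map_mul,
    reflect_mul _ _ (by rwa [natDegree_map]) (by rwa [natDegree_map])]

theorem eval_starPoly {N : ℕ} {p : ℂ[X]} (hp : p.natDegree ≤ N) {z : ℂ} (hz : z ≠ 0) :
    (starPoly N p).eval z = z ^ N * starRingEnd ℂ (p.eval (starRingEnd ℂ z)⁻¹) := by
  rw [eval_eq_sum_range' (Nat.lt_succ_of_le hp), starPoly, eval_finsetSum, map_sum,
    Finset.mul_sum]
  refine Finset.sum_congr rfl fun k hk => ?_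
  have hk' : k ≤ N := by simpa [Nat.lt_succ_iff] using hk
  simp only [eval_mul, eval_C, eval_pow, eval_X, map_mul, map_pow, map_inv₀,
    Complex.conj_conj]
  rw [pow_sub₀ _ hz hk', inv_pow]
  ring

theorem eval_zero_starPoly {N : ℕ} {p : ℂ[X]} (hp : p.natDegree ≤ N) :
    (starPoly N p).eval 0 = starRingEnd ℂ (p.coeff N) := by
  rw [← coeff_zero_eq_eval_zero, starPoly_eq_reflect hp, coeff_reflect]
  simp

/-- On the unit circle, `G · G* = z ^ m |G| ^ 2`. -/
theorem eval_mul_starPoly {m : ℕ} {G : ℂ[X]} (hG : G.natDegree ≤ m) {z : ℂ} (hz : ‖z‖ = 1) :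
    (G * starPoly m G).eval z = z ^ m * ((‖G.eval z‖ ^ 2 : ℝ) : ℂ) := by
  have h0 : z ≠ 0 := by rintro rfl; simp at hz
  have h1 : (starRingEnd ℂ z)⁻¹ = z := by
    rw [← map_inv₀, Complex.inv_eq_conj hz, Complex.conj_conj]
  rw [eval_mul, eval_starPoly hG h0, h1, Complex.ofReal_pow, ← Complex.mul_conj']
  ring

/-- Nonzero zeros of `G*` are reflections in the circle of zeros of `G`, hence lie outside the
closed disk; at 0, monicity gives `G*(0) = 1`. -/
theorem isCoprime_starPoly {G : ℂ[X]} (hG : G.Monic) (hroot : ∀ a, G.eval a = 0 → ‖a‖ < 1) :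
    IsCoprime G (starPoly G.natDegree G) := by
  rw [isCoprime_iff_aeval_ne_zero_of_isAlgClosed ℂ ℂ]
  intro a
  by_contra! h
  simp only [coe_aeval_eq_eval] at h
  obtain ⟨h1, h2⟩ := h
  by_cases ha : a = 0
  · subst ha
    rw [eval_zero_starPoly le_rfl] at h2
    simp [hG.coeff_natDegree] at h2
  · rw [eval_starPoly le_rfl ha] at h2
    have h3 : G.eval (starRingEnd ℂ a)⁻¹ = 0 := by simpa [ha] using h2
    have h4 := hroot _ h3
    have h5 := hroot _ h1
    rw [norm_inv, RCLike.norm_conj] at h4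
    exact absurd h4 (not_lt.2 (one_le_inv₀ (norm_pos_iff.2 ha) |>.2 h5.le))

theorem starPoly_ne_zero {N : ℕ} {p : ℂ[X]} (hp : p.natDegree ≤ N) (h0 : p ≠ 0) :
    starPoly N p ≠ 0 := by
  intro h
  apply h0
  rw [← starPoly_starPoly hp, h]
  simp [starPoly]

/-- The common divisor of `p` and `p*` carrying the common zeros in the disk. -/
theorem exists_monic_dvd (N : ℕ) (p : ℂ[X]) :
    ∃ G : ℂ[X], G.Monic ∧ G.natDegree = commonMult N p ∧ (∀ a, G.eval a = 0 → ‖a‖ < 1) ∧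
      G ∣ p ∧ G ∣ starPoly N p := by
  let μ : ℂ → ℕ := fun a => min (p.rootMultiplicity a) ((starPoly N p).rootMultiplicity a)
  have hmon : ∀ a ∈ commonZeros p (starPoly N p), ((X - C a) ^ μ a).Monic :=
    fun a _ => (monic_X_sub_C a).pow _
  have hco : ((commonZeros p (starPoly N p) : Finset ℂ) : Set ℂ).Pairwise
      (Function.onFun IsCoprime fun a => (X - C a) ^ μ a) := fun a _ b _ hab =>
    (pairwise_coprime_X_sub_C Function.injective_id hab).pow
  refine ⟨∏ a ∈ commonZeros p (starPoly N p), (X - C a) ^ μ a, monic_prod_of_monic _ _ hmon,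
    ?_, ?_, ?_, ?_⟩
  · rw [natDegree_prod_of_monic _ _ hmon, commonMult]
    simp [μ]
  · intro a ha
    rw [eval_prod, Finset.prod_eq_zero_iff] at ha
    obtain ⟨b, hb, hab⟩ := ha
    rw [eval_pow] at hab
    have : a = b := by simpa [sub_eq_zero] using eq_zero_of_pow_eq_zero hab
    rw [this]
    exact (Finset.mem_filter.1 hb).2
  · exact Finset.prod_dvd_of_coprime hco fun a _ =>
      (pow_dvd_pow _ (min_le_left _ _)).trans (pow_rootMultiplicity_dvd p a)
  · exact Finset.prod_dvd_of_coprime hco fun a _ =>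
      (pow_dvd_pow _ (min_le_right _ _)).trans (pow_rootMultiplicity_dvd _ a)

/-- Starring `p* = G h` gives `p = G* h*`; since `G` divides `p` and is coprime to `G*`, it divides
`h*`. -/
theorem exists_factorization {N : ℕ} {p : ℂ[X]} (hp : p.natDegree ≤ N) (h0 : p ≠ 0) :
    ∃ G r : ℂ[X], G.natDegree = commonMult N p ∧ (∀ a, G.eval a = 0 → ‖a‖ < 1) ∧
      p = G * starPoly (commonMult N p) G * r ∧ r.natDegree + 2 * commonMult N p ≤ N := by
  obtain ⟨G, hG, hdeg, hroot, hGp, h, hh⟩ := exists_monic_dvd N p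
  have hs0 := starPoly_ne_zero hp h0
  have hh0 : h ≠ 0 := by rintro rfl; simp [hh] at hs0
  have hd : G.natDegree + h.natDegree ≤ N := by
    rw [← natDegree_mul hG.ne_zero hh0, ← hh]
    exact natDegree_starPoly_le N p
  obtain ⟨n, rfl⟩ := Nat.exists_eq_add_of_le (Nat.le_of_add_right_le hd)
  have hpf : p = starPoly G.natDegree G * starPoly n h := by
    rw [← starPoly_mul le_rfl (by omega), ← hh, starPoly_starPoly hp]
  obtain ⟨r, hr⟩ : G ∣ starPoly n h :=
    (isCoprime_starPoly hG hroot).dvd_of_dvd_mul_left (hpf ▸ hGp)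
  have hr0 : r ≠ 0 := by
    rintro rfl
    exact h0 (by rw [hpf, hr]; simp)
  have hd2 := natDegree_starPoly_le n h
  rw [hr, natDegree_mul hG.ne_zero hr0] at hd2
  refine ⟨G, r, hdeg, hroot, ?_, by omega⟩
  rw [← hdeg]
  nth_rewrite 1 [hpf]
  rw [hr]
  ring

/-! ### Real trigonometric polynomials -/

/-- The polynomial `z ^ m T(z)`, where `T` is the real trigonometric polynomial of degree at most
`m` with coefficients `x`. -/
noncomputable def trigPoly (m : ℕ) (x : ℝ × (Fin m → ℂ)) : ℂ[X] :=
  C (x.1 : ℂ) * X ^ m + ∑ j : Fin m, (C (x.2 j) * X ^ (m + 1 + (j : ℕ)) +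
    C (starRingEnd ℂ (x.2 j)) * X ^ (m - 1 - (j : ℕ)))

/-- The value at `z` of the real trigonometric polynomial with coefficients `x`. -/
noncomputable def trigVal (m : ℕ) (x : ℝ × (Fin m → ℂ)) (z : ℂ) : ℝ :=
  x.1 + ∑ j : Fin m, 2 * (x.2 j * z ^ ((j : ℕ) + 1)).re

theorem eval_trigPoly (m : ℕ) (x : ℝ × (Fin m → ℂ)) {z : ℂ} (hz : ‖z‖ = 1) :
    (trigPoly m x).eval z = z ^ m * (trigVal m x z : ℂ) := by
  have hzz : z * starRingEnd ℂ z = 1 := by rw [Complex.mul_conj']; simp [hz]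
  simp only [trigPoly, trigVal, eval_add, eval_mul, eval_C, eval_pow, eval_X, eval_finsetSum,
    Complex.ofReal_add, Complex.ofReal_sum, mul_add, Finset.mul_sum]
  rw [mul_comm (z ^ m)]
  congr 1
  refine Finset.sum_congr rfl fun j _ => ?_
  -- Since `j < m`, the subtraction in `m - 1 - j` is not truncated.
  obtain ⟨i, hi⟩ : ∃ i, m = i + ((j : ℕ) + 1) := Nat.exists_eq_add_of_le' j.2
  have h1 : m - 1 - (j : ℕ) = i := by omega
  have h2 : z ^ m * starRingEnd ℂ z ^ ((j : ℕ) + 1) = z ^ i := by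
    calc z ^ m * starRingEnd ℂ z ^ ((j : ℕ) + 1)
        = z ^ (i + ((j : ℕ) + 1)) * starRingEnd ℂ z ^ ((j : ℕ) + 1) := by rw [← hi]
      _ = z ^ i := by rw [pow_add, mul_assoc, ← mul_pow, hzz, one_pow, mul_one]
  rw [h1, ← h2, ← Complex.add_conj, map_mul, map_pow]
  ring

theorem natDegree_trigPoly_le (m : ℕ) (x : ℝ × (Fin m → ℂ)) :
    (trigPoly m x).natDegree ≤ 2 * m := by
  refine natDegree_add_le_of_degree_le ((natDegree_C_mul_X_pow_le _ _).trans (by omega))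
    (natDegree_sum_le_of_forall_le _ _ fun j _ => natDegree_add_le_of_degree_le
      ((natDegree_C_mul_X_pow_le _ _).trans (by omega))
      ((natDegree_C_mul_X_pow_le _ _).trans (by omega)))

theorem trigPoly_add (m : ℕ) (x y : ℝ × (Fin m → ℂ)) :
    trigPoly m (x + y) = trigPoly m x + trigPoly m y := by
  simp only [trigPoly, Prod.fst_add, Prod.snd_add, Pi.add_apply, Complex.ofReal_add, map_add,
    add_mul, Finset.sum_add_distrib]
  ring

theorem trigPoly_smul (m : ℕ) (s : ℝ) (x : ℝ × (Fin m → ℂ)) :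
    trigPoly m (s • x) = s • trigPoly m x := by
  have hs : ∀ f : ℂ[X], s • f = C (s : ℂ) * f := fun f => by
    ext i; simp
  rw [hs]
  simp only [trigPoly, Prod.smul_fst, Prod.smul_snd, Pi.smul_apply, smul_eq_mul,
    Complex.real_smul, Complex.ofReal_mul, map_mul, Complex.conj_ofReal, mul_add, Finset.mul_sum,
    mul_assoc]

theorem trigVal_add (m : ℕ) (x y : ℝ × (Fin m → ℂ)) (z : ℂ) :
    trigVal m (x + y) z = trigVal m x z + trigVal m y z := by
  simp only [trigVal, Prod.fst_add, Prod.snd_add, Pi.add_apply, add_mul, Complex.add_re, mul_add,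
    Finset.sum_add_distrib]
  ring

theorem trigVal_smul (m : ℕ) (s : ℝ) (x : ℝ × (Fin m → ℂ)) (z : ℂ) :
    trigVal m (s • x) z = s * trigVal m x z := by
  simp only [trigVal, Prod.smul_fst, Prod.smul_snd, Pi.smul_apply, smul_eq_mul,
    smul_mul_assoc, Complex.smul_re, mul_add, Finset.mul_sum]
  congr 1
  exact Finset.sum_congr rfl fun j _ => by ring

theorem continuous_trigVal (m : ℕ) (x : ℝ × (Fin m → ℂ)) : Continuous (trigVal m x) := by
  unfold trigVal
  fun_prop

theorem eq_zero_of_trigPoly_eq_zero {m : ℕ} {x : ℝ × (Fin m → ℂ)} (h : trigPoly m x = 0) :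
    x = 0 := by
  have hc : ∀ i, (trigPoly m x).coeff i = 0 := by simp [h]
  simp only [trigPoly, coeff_add, finsetSum_coeff, coeff_C_mul_X_pow] at hc
  refine Prod.ext ?_ (funext fun l => ?_)
  · have h1 := hc m
    rw [Finset.sum_eq_zero fun j _ => by
      rw [if_neg (by omega), if_neg (by omega), add_zero]] at h1
    simpa using h1
  · have h1 := hc (m + 1 + l)
    rw [if_neg (by omega), Finset.sum_eq_single l (fun j _ hj => by
      rw [if_neg (by have := Fin.val_ne_of_ne hj; omega), if_neg (by omega), add_zero])
      (by simp), if_pos rfl, if_neg (by omega)] at h1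
    simpa using h1

/-! ### Admissible perturbations and the norm -/

theorem continuous_eval_exp (p : ℂ[X]) :
    Continuous fun t : ℝ => p.eval (Complex.exp (t * Complex.I)) :=
  p.continuous.comp (by fun_prop)

theorem continuous_trigVal_exp (m : ℕ) (x : ℝ × (Fin m → ℂ)) :
    Continuous fun t : ℝ => trigVal m x (Complex.exp (t * Complex.I)) :=
  (continuous_trigVal m x).comp (by fun_prop)

/-- The real linear constraints which keep the perturbation `r · trigPoly m x` in the polynomial
space and keep the norm unchanged. -/
noncomputable def constraintMap (m : ℕ) (K : Finset ℕ) (r : ℂ[X]) :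
    (ℝ × (Fin m → ℂ)) →ₗ[ℝ] ℝ × (K → ℂ) where
  toFun x := (∫ t in (0 : ℝ)..(2 * Real.pi), ‖r.eval (Complex.exp (t * Complex.I))‖ *
      trigVal m x (Complex.exp (t * Complex.I)), fun k => (r * trigPoly m x).coeff k)
  map_add' x y := by
    refine Prod.ext ?_ (funext fun k => by simp [trigPoly_add, mul_add])
    simp only [trigVal_add, mul_add, Prod.fst_add]
    exact intervalIntegral.integral_add
      (((continuous_eval_exp r).norm.mul (continuous_trigVal_exp m x)).intervalIntegrable _ _)
      (((continuous_eval_exp r).norm.mul (continuous_trigVal_exp m y)).intervalIntegrable _ _)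
  map_smul' s x := by
    refine Prod.ext ?_ (funext fun k => by simp [trigPoly_smul])
    simp only [trigVal_smul, Prod.smul_fst, smul_eq_mul, RingHom.id_apply]
    rw [← intervalIntegral.integral_const_mul]
    congr 1
    ext t
    ring

theorem exists_constraintMap_eq_zero {m : ℕ} {K : Finset ℕ} (hK : K.card < m) (r : ℂ[X]) :
    ∃ x, x ≠ 0 ∧ constraintMap m K r x = 0 := by
  have h : LinearMap.ker (constraintMap m K r) ≠ ⊥ := by
    -- Real dimensions: `1 + 2M` in the target against `1 + 2m` in the source.
    apply LinearMap.ker_ne_bot_of_finrank_lt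
    simp [Module.finrank_pi_fintype, Complex.finrank_real_complex]
    omega
  obtain ⟨x, hx, hx0⟩ := Submodule.exists_mem_ne_zero_of_ne_bot h
  exact ⟨x, hx0, hx⟩

theorem exists_pos_perturbation {w T : ℝ → ℝ} (hw : Continuous w) (hT : Continuous T)
    (hpos : ∀ t, 0 < w t) (a b : ℝ) :
    ∃ ε > 0, ∀ s, |s| ≤ ε → ∀ t ∈ Set.Icc a b, 0 ≤ w t + s * T t := by
  obtain ⟨B, hB⟩ := (isCompact_Icc (a := a) (b := b)).exists_bound_of_continuousOn
    (hT.div hw fun t => (hpos t).ne').continuousOn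
  -- `B` bounds `|T / w|` on the compact interval; `|B| + 1` keeps the inverse positive even when `B
  -- = 0`.
  refine ⟨(|B| + 1)⁻¹, by positivity, fun s hs t ht => ?_⟩
  have h1 : |T t| ≤ (|B| + 1) * w t := by
    have h2 := hB t ht
    rw [Pi.div_apply, Real.norm_eq_abs, abs_div, abs_of_pos (hpos t), div_le_iff₀ (hpos t)] at h2
    exact h2.trans (mul_le_mul_of_nonneg_right (by linarith [le_abs_self B]) (hpos t).le)
  have h3 : |s * T t| ≤ w t := by
    rw [abs_mul]
    calc |s| * |T t| ≤ (|B| + 1)⁻¹ * ((|B| + 1) * w t) := by gcongr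
      _ = w t := by field_simp
  linarith [neg_le_of_abs_le h3]

/-- Perturbations of `p = G G* r` within the kernel of the constraints do not change the norm. -/
theorem l1Norm_add_perturbation {m : ℕ} {G r : ℂ[X]} (hG : G.natDegree ≤ m)
    {x : ℝ × (Fin m → ℂ)} {s : ℝ}
    (hs : ∀ t ∈ Set.Icc 0 (2 * Real.pi), 0 ≤ ‖G.eval (Complex.exp (t * Complex.I))‖ ^ 2 +
      s * trigVal m x (Complex.exp (t * Complex.I)))
    (hx : ∫ t in (0 : ℝ)..(2 * Real.pi), ‖r.eval (Complex.exp (t * Complex.I))‖ *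
      trigVal m x (Complex.exp (t * Complex.I)) = 0) :
    l1Norm (G * starPoly m G * r + s • (r * trigPoly m x)) = l1Norm (G * starPoly m G * r) := by
  have hz : ∀ t : ℝ, ‖Complex.exp (t * Complex.I)‖ = 1 := Complex.norm_exp_ofReal_mul_I
  have h0 : ∀ t : ℝ, ‖(G * starPoly m G * r).eval (Complex.exp (t * Complex.I))‖ =
      ‖r.eval (Complex.exp (t * Complex.I))‖ * ‖G.eval (Complex.exp (t * Complex.I))‖ ^ 2 := by
    intro t
    rw [eval_mul, eval_mul_starPoly hG (hz t), norm_mul, norm_mul, norm_pow, hz, one_pow, one_mul,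
      Complex.norm_real, Real.norm_of_nonneg (by positivity), mul_comm]
  have h1 : ∀ t ∈ Set.uIcc 0 (2 * Real.pi),
      ‖(G * starPoly m G * r + s • (r * trigPoly m x)).eval (Complex.exp (t * Complex.I))‖ =
      ‖(G * starPoly m G * r).eval (Complex.exp (t * Complex.I))‖ +
        s * (‖r.eval (Complex.exp (t * Complex.I))‖ *
          trigVal m x (Complex.exp (t * Complex.I))) := by
    intro t ht
    rw [Set.uIcc_of_le Real.two_pi_pos.le] at ht
    have h2 : (G * starPoly m G * r + s • (r * trigPoly m x)).eval (Complex.exp (t * Complex.I)) =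
        Complex.exp (t * Complex.I) ^ m * r.eval (Complex.exp (t * Complex.I)) *
        ((‖G.eval (Complex.exp (t * Complex.I))‖ ^ 2 +
          s * trigVal m x (Complex.exp (t * Complex.I)) : ℝ) : ℂ) := by
      rw [eval_add, eval_mul, eval_mul_starPoly hG (hz t), eval_smul, eval_mul,
        eval_trigPoly m x (hz t), Complex.real_smul]
      push_cast
      ring
    rw [h2, h0, norm_mul, norm_mul, norm_pow, hz, one_pow, one_mul, Complex.norm_real,
      Real.norm_of_nonneg (hs t ht)]
    ring
  have h3 : Continuous fun t : ℝ => s * (‖r.eval (Complex.exp (t * Complex.I))‖ *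
      trigVal m x (Complex.exp (t * Complex.I))) :=
    continuous_const.mul ((continuous_eval_exp r).norm.mul (continuous_trigVal_exp m x))
  rw [l1Norm, l1Norm, intervalIntegral.integral_congr h1, intervalIntegral.integral_add
    ((continuous_eval_exp _).norm.intervalIntegrable _ _) (h3.intervalIntegrable _ _),
    intervalIntegral.integral_const_mul, hx, mul_zero, add_zero]

theorem natDegree_le_of_mem_polySpace {N : ℕ} {K : Finset ℕ} {p : ℂ[X]}
    (hp : p ∈ polySpace (freqSet N K)) : p.natDegree ≤ N :=
  natDegree_le_iff_coeff_eq_zero.2 fun k hk => hp k (by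
    simp only [freqSet, Finset.mem_sdiff, Finset.mem_range]; omega)

theorem mem_polySpace_freqSet {N : ℕ} {K : Finset ℕ} {p : ℂ[X]} (hN : p.natDegree ≤ N)
    (hK : ∀ k ∈ K, p.coeff k = 0) : p ∈ polySpace (freqSet N K) := by
  intro k hk
  by_cases hkK : k ∈ K
  · exact hK k hkK
  · exact coeff_eq_zero_of_natDegree_lt (by
      simp only [freqSet, Finset.mem_sdiff, Finset.mem_range, hkK, not_false_eq_true, and_true] at hk
      omega)

theorem notMem_extremePoints_of_symmetric {E : Type*} [AddCommGroup E] [Module ℝ E] {A : Set E}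
    {p q : E} (hq : q ≠ 0) (h1 : p + q ∈ A) (h2 : p - q ∈ A) : p ∉ A.extremePoints ℝ := by
  intro h
  have h3 : p ∈ openSegment ℝ (p + q) (p - q) :=
    ⟨1 / 2, 1 / 2, by norm_num, by norm_num, by norm_num, by module⟩
  exact hq (by simpa using (mem_extremePoints_iff_left.1 h).2 _ h1 _ h2 h3)

end Fewnomial

theorem corollary2p2 (N : ℕ) (hN : 0 < N) (K : Finset ℕ) (hK : ∀ k ∈ K, 0 < k ∧ k < N)
    (p : Fewnomial.polySpace (Fewnomial.freqSet N K))
    (hp : Fewnomial.l1Norm (p : Polynomial ℂ) = 1)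
    (hm : K.card < Fewnomial.commonMult N (p : Polynomial ℂ)) :
    p ∉ Set.extremePoints ℝ (Fewnomial.unitBall (Fewnomial.freqSet N K)) := by
  open Fewnomial Polynomial in
  obtain ⟨p, hpmem⟩ := p
  simp only at hp hm
  have hp0 : p ≠ 0 := by rintro rfl; simp [l1Norm] at hp
  obtain ⟨G, r, hG, hroot, hfac, hr⟩ :=
    exists_factorization (natDegree_le_of_mem_polySpace hpmem) hp0
  generalize commonMult N p = m at *
  obtain ⟨x, hx0, hx⟩ := exists_constraintMap_eq_zero hm r
  have hx1 := congrArg Prod.fst hx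
  have hx2 : ∀ k ∈ K, (r * trigPoly m x).coeff k = 0 := fun k hk =>
    congrFun (congrArg Prod.snd hx) ⟨k, hk⟩
  have hq0 : r * trigPoly m x ≠ 0 := mul_ne_zero
    (by rintro rfl; exact hp0 (by simpa using hfac)) (mt eq_zero_of_trigPoly_eq_zero hx0)
  have hqmem : r * trigPoly m x ∈ polySpace (freqSet N K) := by
    refine mem_polySpace_freqSet (natDegree_mul_le.trans ?_) hx2
    have := natDegree_trigPoly_le m x
    omega
  obtain ⟨ε, hε, hpos⟩ := exists_pos_perturbation ((continuous_eval_exp G).norm.pow 2)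
    (continuous_trigVal_exp m x) (fun t => by
      -- The zeros of `G` lie in the open disk, so none is on the circle.
      have : G.eval (Complex.exp (t * Complex.I)) ≠ 0 := fun h => by
        have := hroot _ h
        rw [Complex.norm_exp_ofReal_mul_I] at this
        exact lt_irrefl _ this
      exact pow_pos (norm_pos_iff.2 this) 2) 0 (2 * Real.pi)
  have hnorm : ∀ s : ℝ, |s| ≤ ε → l1Norm (p + s • (r * trigPoly m x)) = 1 := fun s hs => by
    rw [hfac, l1Norm_add_perturbation hG.le (hpos s hs) hx1, ← hfac, hp]
  refine notMem_extremePoints_of_symmetric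
    (q := ε • (⟨r * trigPoly m x, hqmem⟩ : polySpace (freqSet N K))) ?_ ?_ ?_
  · exact smul_ne_zero hε.ne' fun h => hq0 (congrArg Subtype.val h)
  · exact (hnorm ε (abs_of_pos hε).le).le
  · have h := (hnorm (-ε) (by rw [abs_neg, abs_of_pos hε])).le
    rw [neg_smul, ← sub_eq_add_neg] at h
    exact h
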